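/- **Theorem 1.2.** Let $|\cdot|$ be the Euclidean norm on $\mathbb{R}^3$ and $\|\cdot\|_2$ the norm of $L^2(\mathbb{R}^3)$. Let $C_0^\infty(\mathbb{R}^3\setminus\{0\})$ be the space of complex-valued $C^\infty$ functions with compact support contained in $\mathbb{R}^3\setminus\{0\}$ (extended by $0$ to the origin). Let $\Delta$ be the Laplacian on $\mathbb{R}^3$ and decompose $\Delta=\Delta_r+\Delta_s$ away from the origin, where $$\Delta_r=\partial_r^2+\frac{2}{|x|}\,\partial_r,\qquad \partial_r=\frac{x}{|x|}\cdot\nabla,\qquad \Delta_s=\frac{1}{|x|^2}\,\Delta_{\mathbb{S}^2},$$ and $\Delta_{\mathbb{S}^2}$ is the Laplace–Beltrami operator of the unit sphere $\mathbb{S}^2$, acting in the angular variable $x/|x|$. For every $f\in C_0^\infty(\mathbb{R}^3\setminus\{0\})$, the functions $\Delta f$, $\Delta_r f$ and $\Delta_s f$ belong to $L^2(\mathbb{R}^3)$ and $$\|\Delta f\|_2^2\ \ge\ \|\Delta_r f\|_2^2+\tfrac14\|\Delta_s f\|_2^2 .$$ This strictly improves the Bez–Machihara–Ozawa bound $\|\Delta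 f\|_2^2\ge\|\Delta_r f\|_2^2$: there is an $f\in C_0^\infty(\mathbb{R}^3\setminus\{0\})$ with $\|\Delta_r f\|_2^2+\tfrac14\|\Delta_s f\|_2^2>\|\Delta_r f\|_2^2$. More generally, for all real $k_1\in[0,1]$ and $k_2\in[0,25/64]$ with $9k_1+64k_2\le 25$, and every $f\in C_0^\infty(\mathbb{R}^3\setminus\{0\})$, $$\|\Delta f\|_2^2\ \ge\ k_1\|\Delta_r f\|_2^2+k_2\|\Delta_s f\|_2^2 .$$ -/

import Mathlib

open MeasureTheory InnerProductSpace
open scoped ContDiff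

namespace EvansLewis

/-- The class `C₀^∞(ℝⁿ ∖ {0})`: smooth complex-valued functions with compact support contained in
`ℝⁿ ∖ {0}` (extended by zero to the origin). -/
structure IsPuncturedTestFunction {n : ℕ} (f : EuclideanSpace ℝ (Fin n) → ℂ) : Prop where
  contDiff : ContDiff ℝ ∞ f
  hasCompactSupport : HasCompactSupport f
  zero_notMem_tsupport : (0 : EuclideanSpace ℝ (Fin n)) ∉ tsupport f

/-- The radial derivative `∂ᵣ f = (x / |x|) · ∇f`. -/
noncomputable def radialDeriv {n : ℕ} (f : EuclideanSpace ℝ (Fin n) → ℂ) :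
    EuclideanSpace ℝ (Fin n) → ℂ :=
  fun x => fderiv ℝ f x (‖x‖⁻¹ • x)

/-- The radial Laplacian `Δᵣ f = ∂ᵣ² f + ((n - 1) / |x|) ∂ᵣ f`. -/
noncomputable def radialLaplacian {n : ℕ} (f : EuclideanSpace ℝ (Fin n) → ℂ) :
    EuclideanSpace ℝ (Fin n) → ℂ :=
  fun x => radialDeriv (radialDeriv f) x + (((n : ℝ) - 1) / ‖x‖) • radialDeriv f x

/-- The Laplace-Beltrami operator of the unit sphere `𝕊ⁿ⁻¹`, applied to the restriction of `g` to
the sphere and evaluated at a point `p` of the sphere: the Euclidean Laplacian at `p` of the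
extension `y ↦ g (y / |y|)` of `g|_𝕊` that is constant along rays. -/
noncomputable def sphereLaplaceBeltrami {n : ℕ} (g : EuclideanSpace ℝ (Fin n) → ℂ)
    (p : EuclideanSpace ℝ (Fin n)) : ℂ :=
  (Laplacian.laplacian (fun y : EuclideanSpace ℝ (Fin n) => g (‖y‖⁻¹ • y))) p

/-- The spherical part `Δₛ f = |x|⁻² Δ_𝕊 f` of the Laplacian: at `x ≠ 0` with `r = |x|` and
`ω = x / |x|`, the operator `Δ_𝕊` acts on the function `θ ↦ f (r θ)` on the unit sphere
and the result is evaluated at `ω`. -/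
noncomputable def sphericalLaplacian {n : ℕ} (f : EuclideanSpace ℝ (Fin n) → ℂ) :
    EuclideanSpace ℝ (Fin n) → ℂ :=
  fun x => (‖x‖ ^ 2)⁻¹ • sphereLaplaceBeltrami (fun θ => f (‖x‖ • θ)) (‖x‖⁻¹ • x)

/-- The `L²(ℝⁿ)` norm. -/
noncomputable def l2Norm {n : ℕ} (g : EuclideanSpace ℝ (Fin n) → ℂ) : ℝ :=
  (eLpNorm g 2 volume).toReal

end EvansLewis

/-! Let E = x·∇ be the Euler field, R_i the infinitesimal rotations and C = ∑ R_i². Away from the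
origin |x|²Δ = (E² + E) + C, the summands being |x|²Δᵣ and |x|²Δₛ, so all three norms become norms
in L²(|x|⁻⁴dx). There D = E − 1/2 and the R_i are antisymmetric, and D commutes with every R_i.

Put G = ∑ ‖R_i f‖². As E² + E = D² + 2D + 3/4, integrating by parts gives ⟨(E² + E)f, Cf⟩ = ∑ (‖D
R_i f‖² − ¾‖R_i f‖²) ≥ −¾G. The spectral gap 2G ≤ ‖Cf‖² (`two_mul_sum_weightedInner_rot_le`) bounds
twice this cross term below by −¾‖Cf‖², so a quarter of ‖Cf‖² survives.

The gap is obtained without spherical harmonics: the pointwise Bochner-type bound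
`norm_rotCasimir_sq_le` is integrated and combined with ∑ ‖R_i R_j f‖² = ‖Cf‖², which holds because
C commutes with the rotations. Adding the radial Rellich inequality with constant 9/16 gives ‖Δf‖² ≥
(25/64)‖Δₛf‖², and the weighted family follows by convex combination of the two bounds. -/

namespace EvansLewis

/-! ### Calculus along linear vector fields -/

section LinearVectorField

variable {E F : Type*} [NormedAddCommGroup E] [NormedSpace ℝ E]
  [NormedAddCommGroup F] [NormedSpace ℝ F]

/-- The derivative of `f` along the linear vector field `x ↦ A x`. -/
noncomputable def linDeriv (A : E →L[ℝ] E) (f : E → F) : E → F :=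
  fun x => fderiv ℝ f x (A x)

theorem linDeriv_apply (A : E →L[ℝ] E) (f : E → F) (x : E) :
    linDeriv A f x = fderiv ℝ f x (A x) := rfl

theorem linDeriv_congr {A : E →L[ℝ] E} {f g : E → F} {x : E} (h : f =ᶠ[nhds x] g) :
    linDeriv A f x = linDeriv A g x := by
  rw [linDeriv_apply, linDeriv_apply, h.fderiv_eq]

theorem linDeriv_eventuallyEq {A : E →L[ℝ] E} {f g : E → F} {x : E} (h : f =ᶠ[nhds x] g) :
    linDeriv A f =ᶠ[nhds x] linDeriv A g :=
  h.eventually_nhds.mono fun _ hy => linDeriv_congr hy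

theorem linDeriv_linDeriv_apply {A B : E →L[ℝ] E} {f : E → F} {x : E}
    (hf : ContDiffAt ℝ 2 f x) :
    linDeriv A (linDeriv B f) x
      = fderiv ℝ (fderiv ℝ f) x (A x) (B x) + fderiv ℝ f x (B (A x)) := by
  have h : DifferentiableAt ℝ (fderiv ℝ f) x :=
    (hf.fderiv_right (m := 1) (by norm_num)).differentiableAt (by norm_num)
  have h2 : HasFDerivAt (fun y => fderiv ℝ f y (B y)) _ x :=
    h.hasFDerivAt.clm_apply B.hasFDerivAt
  rw [linDeriv_apply, show linDeriv B f = fun y => fderiv ℝ f y (B y) from rfl, h2.fderiv]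
  simp [add_comm]

/-- Symmetry of the second derivative cancels the second-order terms. The matrix commutator appears
reversed because composing derivations composes the linear maps in the opposite order. -/
theorem linDeriv_comm {A B : E →L[ℝ] E} {f : E → F} {x : E} (hf : ContDiffAt ℝ 2 f x) :
    linDeriv A (linDeriv B f) x - linDeriv B (linDeriv A f) x
      = linDeriv (B.comp A - A.comp B) f x := by
  have h := (hf.isSymmSndFDerivAt (by simp)).eq (A x) (B x)
  rw [linDeriv_linDeriv_apply hf, linDeriv_linDeriv_apply hf, linDeriv_apply, h]
  simp

theorem _root_.ContDiff.linDeriv {f : E → F} (hf : ContDiff ℝ ∞ f) (A : E →L[ℝ] E) :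
    ContDiff ℝ ∞ (linDeriv A f) :=
  (hf.fderiv_right (m := ∞) (by simp)).clm_apply A.contDiff

theorem support_linDeriv_subset (A : E →L[ℝ] E) (f : E → F) :
    Function.support (linDeriv A f) ⊆ tsupport f := by
  refine Set.Subset.trans ?_ (support_fderiv_subset ℝ)
  intro x hx h
  exact hx (by rw [linDeriv_apply, h]; simp)

theorem tsupport_linDeriv_subset (A : E →L[ℝ] E) (f : E → F) :
    tsupport (linDeriv A f) ⊆ tsupport f :=
  closure_minimal (support_linDeriv_subset A f) (isClosed_tsupport f)

theorem linDeriv_smul {A : E →L[ℝ] E} {w : E → ℝ} {f : E → F} {x : E}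
    (hw : DifferentiableAt ℝ w x) (hf : DifferentiableAt ℝ f x) :
    linDeriv A (fun y => w y • f y) x = linDeriv A w x • f x + w x • linDeriv A f x := by
  simp only [linDeriv_apply]
  rw [fderiv_fun_smul hw hf]
  simp [add_comm]

theorem linDeriv_add {A : E →L[ℝ] E} {f g : E → F} {x : E}
    (hf : DifferentiableAt ℝ f x) (hg : DifferentiableAt ℝ g x) :
    linDeriv A (f + g) x = linDeriv A f x + linDeriv A g x := by
  simp [linDeriv_apply, fderiv_add hf hg]

theorem linDeriv_const_smul {A : E →L[ℝ] E} {f : E → F} {x : E} (c : ℝ)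
    (hf : DifferentiableAt ℝ f x) :
    linDeriv A (c • f) x = c • linDeriv A f x := by
  simp [linDeriv_apply, fderiv_const_smul hf]

end LinearVectorField

theorem linDeriv_inner {E F : Type*} [NormedAddCommGroup E] [NormedSpace ℝ E]
    [NormedAddCommGroup F] [InnerProductSpace ℝ F] {A : E →L[ℝ] E} {f g : E → F} {x : E}
    (hf : DifferentiableAt ℝ f x) (hg : DifferentiableAt ℝ g x) :
    linDeriv A (fun y => inner ℝ (f y) (g y)) x
      = inner ℝ (linDeriv A f x) (g x) + inner ℝ (f x) (linDeriv A g x) := by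
  simp only [linDeriv_apply]
  rw [fderiv_inner_apply ℝ hf hg, add_comm]

/-- The divergence theorem for a linear vector field and a compactly supported function. -/
theorem integral_linDeriv {n : ℕ} (A : EuclideanSpace ℝ (Fin n) →L[ℝ] EuclideanSpace ℝ (Fin n))
    {g : EuclideanSpace ℝ (Fin n) → ℝ} (hg : ContDiff ℝ 1 g) (hc : HasCompactSupport g) :
    ∫ x, linDeriv A g x
      = -(∑ i, A (EuclideanSpace.single i 1) i) * ∫ x, g x := by
  have hcoord : ∀ i, ContDiff ℝ 1 fun x => A x i := fun i =>
    (EuclideanSpace.proj (𝕜 := ℝ) i ∘L A).contDiff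
  have hdg : ∀ i, Continuous fun x => fderiv ℝ g x (EuclideanSpace.single i 1) := fun i =>
    (hg.continuous_fderiv (by norm_num)).clm_apply continuous_const
  have hcd : ∀ i x v, fderiv ℝ (fun x => A x i) x v = A v i := fun i x v => by
    have : (fun x => A x i) = (EuclideanSpace.proj (𝕜 := ℝ) i ∘L A) := by ext; simp
    rw [this, ContinuousLinearMap.fderiv]; simp
  have hint : ∀ i, Integrable fun x => A x i * fderiv ℝ g x (EuclideanSpace.single i 1) := by
    intro i
    refine ((hcoord i).continuous.mul (hdg i)).integrable_of_hasCompactSupport ?_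
    exact (hc.fderiv_apply (𝕜 := ℝ) _).mul_left
  have hparts : ∀ i, ∫ x, A x i * fderiv ℝ g x (EuclideanSpace.single i 1)
      = -(A (EuclideanSpace.single i 1) i * ∫ x, g x) := by
    intro i
    rw [integral_mul_fderiv_eq_neg_fderiv_mul_of_integrable (f := fun x => A x i)]
    · simp_rw [hcd, integral_const_mul]
    · simp_rw [hcd]
      exact (hg.continuous.integrable_of_hasCompactSupport hc).const_mul _
    · exact hint i
    · exact ((hcoord i).continuous.mul hg.continuous).integrable_of_hasCompactSupport hc.mul_left
    · exact fun x _ => (hcoord i).differentiable (by norm_num) x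
    · exact fun x _ => hg.differentiable (by norm_num) x
  have hpt : ∀ x, linDeriv A g x
      = ∑ i, A x i * fderiv ℝ g x (EuclideanSpace.single i 1) := by
    intro x
    have h := (EuclideanSpace.basisFun (Fin n) ℝ).sum_repr (A x)
    rw [linDeriv_apply]
    conv_lhs => rw [← h]
    simp [map_sum]
  simp_rw [hpt]
  rw [integral_finsetSum _ fun i _ => hint i, Finset.sum_congr rfl fun i _ => hparts i,
    Finset.sum_neg_distrib, ← Finset.sum_mul, neg_mul]

/-! ### Powers of the norm and projection onto spheres -/

section Norm

variable {E : Type*} [NormedAddCommGroup E] [InnerProductSpace ℝ E]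

theorem fderiv_norm_apply {x : E} (hx : x ≠ 0) (v : E) :
    fderiv ℝ (fun y : E => ‖y‖) x v = ‖x‖⁻¹ * inner ℝ x v := by
  have hd : DifferentiableAt ℝ (fun y : E => ‖y‖) x :=
    (contDiffAt_norm ℝ hx (n := 1)).differentiableAt (by norm_num)
  have h1 : fderiv ℝ (fun y : E => ‖y‖ ^ 2) x v = 2 * inner ℝ x v := by
    rw [(hasStrictFDerivAt_norm_sq x).hasFDerivAt.fderiv]; simp
  rw [fderiv_fun_pow 2 hd] at h1
  have hn : ‖x‖ ≠ 0 := norm_ne_zero_iff.mpr hx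
  simp at h1
  field_simp
  linarith

theorem contDiffAt_inv_norm {x : E} (hx : x ≠ 0) {n : ℕ∞ω} :
    ContDiffAt ℝ n (fun y : E => ‖y‖⁻¹) x :=
  (contDiffAt_norm ℝ hx).inv (norm_ne_zero_iff.mpr hx)

theorem fderiv_inv_norm_apply {x : E} (hx : x ≠ 0) (v : E) :
    fderiv ℝ (fun y : E => ‖y‖⁻¹) x v = -(‖x‖⁻¹ ^ 3 * inner ℝ x v) := by
  have hd : DifferentiableAt ℝ (fun y : E => ‖y‖) x :=
    (contDiffAt_norm ℝ hx (n := 1)).differentiableAt (by norm_num)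
  have hn : ‖x‖ ≠ 0 := norm_ne_zero_iff.mpr hx
  change fderiv ℝ ((fun t : ℝ => t⁻¹) ∘ fun y : E => ‖y‖) x v = _
  rw [((hasDerivAt_inv hn).comp_hasFDerivAt x hd.hasFDerivAt).fderiv]
  simp [fderiv_norm_apply hx]
  field_simp

theorem contDiffAt_inv_norm_sq {x : E} (hx : x ≠ 0) {n : ℕ∞ω} :
    ContDiffAt ℝ n (fun y : E => (‖y‖ ^ 2)⁻¹) x :=
  (contDiff_norm_sq ℝ).contDiffAt.inv (by simpa using hx)

theorem linDeriv_inv_norm_sq {x : E} (hx : x ≠ 0) (A : E →L[ℝ] E) :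
    linDeriv A (fun y : E => (‖y‖ ^ 2)⁻¹) x = -(2 * (‖x‖⁻¹ ^ 4 * inner ℝ x (A x))) := by
  have hd : DifferentiableAt ℝ (fun y : E => ‖y‖⁻¹) x :=
    (contDiffAt_inv_norm hx (n := 1)).differentiableAt (by norm_num)
  have : (fun y : E => (‖y‖ ^ 2)⁻¹) = fun y => (‖y‖⁻¹) ^ 2 := by ext; simp
  rw [this, linDeriv_apply, fderiv_fun_pow 2 hd]
  simp [fderiv_inv_norm_apply hx]
  ring

/-- Projection onto the sphere of radius `R` along rays. -/
noncomputable def sphereProj (R : ℝ) (y : E) : E := R • (‖y‖⁻¹ • y)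

theorem contDiffAt_sphereProj (R : ℝ) {y : E} (hy : y ≠ 0) {n : ℕ∞ω} :
    ContDiffAt ℝ n (sphereProj R) y :=
  ((contDiffAt_inv_norm hy).smul contDiffAt_id).const_smul R

theorem fderiv_sphereProj_apply (R : ℝ) {y : E} (hy : y ≠ 0) (v : E) :
    fderiv ℝ (sphereProj R) y v
      = R • (‖y‖⁻¹ • v - (‖y‖⁻¹ ^ 3 * inner ℝ y v) • y) := by
  have h1 : DifferentiableAt ℝ (fun y : E => ‖y‖⁻¹) y :=
    (contDiffAt_inv_norm hy (n := 1)).differentiableAt (by norm_num)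
  have h2 : DifferentiableAt ℝ (fun y : E => ‖y‖⁻¹ • y) y := h1.smul differentiableAt_id
  have h3 : fderiv ℝ (fun y : E => R • (‖y‖⁻¹ • y)) y = R • fderiv ℝ (fun y => ‖y‖⁻¹ • y) y :=
    fderiv_fun_const_smul h2 R
  rw [show sphereProj R = fun y : E => R • (‖y‖⁻¹ • y) from rfl, h3,
    fderiv_fun_smul h1 differentiableAt_fun_id]
  simp [fderiv_inv_norm_apply hy, sub_eq_add_neg]

variable {F : Type*} [NormedAddCommGroup F] [NormedSpace ℝ F]

theorem linDeriv_id_comp_sphereProj {f : E → F} (hf : Differentiable ℝ f) (R : ℝ) {y : E}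
    (hy : y ≠ 0) :
    linDeriv (ContinuousLinearMap.id ℝ E) (f ∘ sphereProj R) y = 0 := by
  have hn : ‖y‖ ≠ 0 := norm_ne_zero_iff.mpr hy
  have hp : DifferentiableAt ℝ (sphereProj R) y :=
    (contDiffAt_sphereProj R hy (n := 1)).differentiableAt (by norm_num)
  rw [linDeriv_apply, fderiv_comp _ (hf _) hp]
  have : fderiv ℝ (sphereProj R) y y = 0 := by
    rw [fderiv_sphereProj_apply R hy, real_inner_self_eq_norm_sq,
      show ‖y‖⁻¹ ^ 3 * ‖y‖ ^ 2 = ‖y‖⁻¹ by field_simp]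
    simp
  simp [this]

/-- A field tangent to spheres does not see the change of ‖y‖, and by linearity it scales along rays
just as the projection does. -/
theorem linDeriv_comp_sphereProj {f : E → F} (hf : Differentiable ℝ f) (R : ℝ) {y : E}
    (hy : y ≠ 0) {A : E →L[ℝ] E} (hA : ∀ x, inner ℝ x (A x) = 0) :
    linDeriv A (f ∘ sphereProj R) y = (linDeriv A f ∘ sphereProj R) y := by
  have hp : DifferentiableAt ℝ (sphereProj R) y :=
    (contDiffAt_sphereProj R hy (n := 1)).differentiableAt (by norm_num)
  rw [linDeriv_apply, fderiv_comp _ (hf _) hp]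
  simp [fderiv_sphereProj_apply R hy, hA, linDeriv_apply, sphereProj]

end Norm

/-! ### Rotation generators and the polar form of the Laplacian -/

/-- The generator `x ↦ eᵢ × x` of the rotations about the `i`-th coordinate axis. -/
noncomputable def rotGen (i : Fin 3) : EuclideanSpace ℝ (Fin 3) →L[ℝ] EuclideanSpace ℝ (Fin 3) :=
  (EuclideanSpace.proj (𝕜 := ℝ) (i + 1)).smulRight (EuclideanSpace.single (i + 2) 1)
    - (EuclideanSpace.proj (𝕜 := ℝ) (i + 2)).smulRight (EuclideanSpace.single (i + 1) 1)

theorem rotGen_apply (i : Fin 3) (x : EuclideanSpace ℝ (Fin 3)) :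
    rotGen i x = x (i + 1) • EuclideanSpace.single (i + 2) (1 : ℝ)
      - x (i + 2) • EuclideanSpace.single (i + 1) (1 : ℝ) := by
  simp [rotGen]

theorem inner_rotGen_self (i : Fin 3) (x : EuclideanSpace ℝ (Fin 3)) :
    inner ℝ x (rotGen i x) = 0 := by
  fin_cases i <;> simp [rotGen_apply, PiLp.inner_apply, Fin.sum_univ_three] <;> ring

theorem trace_rotGen (i : Fin 3) :
    ∑ j, rotGen i (EuclideanSpace.single j 1) j = 0 := by
  fin_cases i <;> simp [rotGen_apply, Fin.sum_univ_three]

theorem sum_rotGen_rotGen (x : EuclideanSpace ℝ (Fin 3)) :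
    ∑ i, rotGen i (rotGen i x) = (-2 : ℝ) • x := by
  ext j
  fin_cases j <;> simp [rotGen_apply, Fin.sum_univ_three] <;> ring

theorem sum_smul_rotGen (x : EuclideanSpace ℝ (Fin 3)) : ∑ i, x i • rotGen i x = 0 := by
  ext j
  fin_cases j <;> simp [rotGen_apply, Fin.sum_univ_three] <;> ring

theorem sum_smul_rotGen_comp (i : Fin 3) (x : EuclideanSpace ℝ (Fin 3)) :
    ∑ j, x j • rotGen j (rotGen i x)
      = x (i + 2) • rotGen (i + 1) x - x (i + 1) • rotGen (i + 2) x := by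
  ext k
  fin_cases i <;> fin_cases k <;> simp [rotGen_apply, Fin.sum_univ_three] <;> ring

theorem rotGen_commutator (i : Fin 3) :
    (rotGen (i + 1)).comp (rotGen i) - (rotGen i).comp (rotGen (i + 1)) = -rotGen (i + 2) := by
  ext x k
  fin_cases i <;> fin_cases k <;> simp [rotGen_apply]

/-- The tensor identity `∑ᵢ (eᵢ × x) ⊗ (eᵢ × x) + x ⊗ x = |x|² I`. -/
theorem sum_bilin_rotGen {F : Type*} [AddCommGroup F] [Module ℝ F]
    (H : EuclideanSpace ℝ (Fin 3) →ₗ[ℝ] EuclideanSpace ℝ (Fin 3) →ₗ[ℝ] F)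
    (x : EuclideanSpace ℝ (Fin 3)) :
    ∑ i, H (rotGen i x) (rotGen i x) + H x x
      = ‖x‖ ^ 2 • ∑ i, H (EuclideanSpace.single i 1) (EuclideanSpace.single i 1) := by
  have h : x = ∑ i, x i • EuclideanSpace.single i (1 : ℝ) := by
    ext j; fin_cases j <;> simp [Fin.sum_univ_three]
  have h2 : H x x = ∑ i, ∑ j, (x i * x j) •
      H (EuclideanSpace.single i 1) (EuclideanSpace.single j 1) := by
    conv_lhs => rw [h]
    simp only [Fin.sum_univ_three, map_add, map_smul, LinearMap.add_apply, LinearMap.smul_apply]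
    module
  rw [h2, EuclideanSpace.real_norm_sq_eq]
  simp only [Fin.sum_univ_three, rotGen_apply, map_sub, map_smul, LinearMap.sub_apply,
    LinearMap.smul_apply]
  simp
  module

/-- The sum of squares of the infinitesimal rotations. -/
noncomputable def rotCasimir {F : Type*} [NormedAddCommGroup F] [NormedSpace ℝ F]
    (f : EuclideanSpace ℝ (Fin 3) → F) : EuclideanSpace ℝ (Fin 3) → F :=
  fun x => ∑ i, linDeriv (rotGen i) (linDeriv (rotGen i) f) x

/-- `|x|²` times the radial Laplacian of a smooth function, in terms of the Euler field. -/
noncomputable def eulerQuad {F : Type*} [NormedAddCommGroup F] [NormedSpace ℝ F]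
    (f : EuclideanSpace ℝ (Fin 3) → F) : EuclideanSpace ℝ (Fin 3) → F :=
  fun x => linDeriv (.id ℝ _) (linDeriv (.id ℝ _) f) x + linDeriv (.id ℝ _) f x

theorem norm_sq_smul_laplacian {F : Type*} [NormedAddCommGroup F] [NormedSpace ℝ F]
    {f : EuclideanSpace ℝ (Fin 3) → F} {x : EuclideanSpace ℝ (Fin 3)} (hf : ContDiffAt ℝ 2 f x) :
    ‖x‖ ^ 2 • (Laplacian.laplacian f) x = eulerQuad f x + rotCasimir f x := by
  let H : EuclideanSpace ℝ (Fin 3) →ₗ[ℝ] EuclideanSpace ℝ (Fin 3) →ₗ[ℝ] F :=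
    LinearMap.mk₂ ℝ (fun v w => fderiv ℝ (fderiv ℝ f) x v w)
      (by simp) (by simp) (by simp) (by simp)
  have hH : ∀ v w, fderiv ℝ (fderiv ℝ f) x v w = H v w := fun _ _ => rfl
  rw [laplacian_eq_iteratedFDeriv_orthonormalBasis f (EuclideanSpace.basisFun (Fin 3) ℝ)]
  -- This −2E cancels the first-order terms of E² + E, each of which contributes one E beyond the
  -- Hessian.
  have hR : ∑ i, fderiv ℝ f x (rotGen i (rotGen i x)) = (-2 : ℝ) • fderiv ℝ f x x := by
    rw [← map_sum, sum_rotGen_rotGen, map_smul]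
  simp only [iteratedFDeriv_two_apply, eulerQuad, rotCasimir, linDeriv_linDeriv_apply hf,
    Finset.sum_add_distrib, hR]
  simp only [EuclideanSpace.basisFun_apply, Matrix.cons_val_zero, Matrix.cons_val_one, hH,
    ← sum_bilin_rotGen, linDeriv_apply, ContinuousLinearMap.id_apply]
  module

theorem laplacian_eq_of_ne_zero {F : Type*} [NormedAddCommGroup F] [NormedSpace ℝ F]
    {f : EuclideanSpace ℝ (Fin 3) → F} {x : EuclideanSpace ℝ (Fin 3)} (hf : ContDiffAt ℝ 2 f x)
    (hx : x ≠ 0) :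
    (Laplacian.laplacian f) x = (‖x‖ ^ 2)⁻¹ • (eulerQuad f x + rotCasimir f x) := by
  have : ‖x‖ ≠ 0 := norm_ne_zero_iff.mpr hx
  rw [← norm_sq_smul_laplacian hf, inv_smul_smul₀ (by positivity)]

theorem radialLaplacian_eq_of_ne_zero {f : EuclideanSpace ℝ (Fin 3) → ℂ}
    {x : EuclideanSpace ℝ (Fin 3)} (hf : ContDiff ℝ ∞ f) (hx : x ≠ 0) :
    radialLaplacian f x = (‖x‖ ^ 2)⁻¹ • eulerQuad f x := by
  have hn : ‖x‖ ≠ 0 := norm_ne_zero_iff.mpr hx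
  have h1 : ∀ g : EuclideanSpace ℝ (Fin 3) → ℂ, ∀ y,
      radialDeriv g y = ‖y‖⁻¹ • linDeriv (.id ℝ _) g y := by
    intro g y; simp [radialDeriv, linDeriv_apply]
  have h2 : radialDeriv f = fun y => ‖y‖⁻¹ • linDeriv (.id ℝ _) f y := funext (h1 f)
  have h3 : linDeriv (.id ℝ _) (radialDeriv f) x
      = -‖x‖⁻¹ • linDeriv (.id ℝ _) f x
        + ‖x‖⁻¹ • linDeriv (.id ℝ _) (linDeriv (.id ℝ _) f) x := by
    rw [h2, linDeriv_smul ((contDiffAt_inv_norm hx (n := 1)).differentiableAt (by norm_num))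
      ((hf.linDeriv _).differentiable (by simp) x)]
    congr 2
    rw [linDeriv_apply, ContinuousLinearMap.id_apply, fderiv_inv_norm_apply hx,
      real_inner_self_eq_norm_sq]
    field_simp
  rw [radialLaplacian, h1 (radialDeriv f), h3, h1 f, eulerQuad]
  simp only [smul_add, smul_smul]
  rw [add_comm (_ • _) (_ • linDeriv _ (linDeriv _ f) x), add_assoc, ← add_smul]
  congr 2
  · field_simp
  · push_cast; field_simp; ring

/-- The extension constant along rays is killed by the Euler field, so at a point of the unit sphere
its full Laplacian reduces to the sum of squared rotations, which pass through the projection. -/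
theorem sphericalLaplacian_eq_of_ne_zero {f : EuclideanSpace ℝ (Fin 3) → ℂ}
    {x : EuclideanSpace ℝ (Fin 3)} (hf : ContDiff ℝ ∞ f) (hx : x ≠ 0) :
    sphericalLaplacian f x = (‖x‖ ^ 2)⁻¹ • rotCasimir f x := by
  have hn : ‖x‖ ≠ 0 := norm_ne_zero_iff.mpr hx
  have hp : ‖x‖⁻¹ • x ≠ 0 := smul_ne_zero (inv_ne_zero hn) hx
  have hpn : ‖‖x‖⁻¹ • x‖ = 1 := by rw [norm_smul]; simp [hn]
  have hproj : sphereProj ‖x‖ (‖x‖⁻¹ • x) = x := by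
    rw [sphereProj, hpn, inv_one, one_smul, smul_inv_smul₀ hn]
  have hne : ∀ᶠ y in nhds (‖x‖⁻¹ • x), y ≠ 0 := isOpen_ne.mem_nhds hp
  have hd : Differentiable ℝ f := hf.differentiable (by simp)
  have hE : linDeriv (.id ℝ _) (f ∘ sphereProj ‖x‖) =ᶠ[nhds (‖x‖⁻¹ • x)] fun _ => 0 :=
    hne.mono fun y hy => linDeriv_id_comp_sphereProj hd _ hy
  have hL : ∀ i, linDeriv (rotGen i) (f ∘ sphereProj ‖x‖)
      =ᶠ[nhds (‖x‖⁻¹ • x)] linDeriv (rotGen i) f ∘ sphereProj ‖x‖ := fun i =>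
    hne.mono fun y hy => linDeriv_comp_sphereProj hd _ hy (inner_rotGen_self i)
  have h2 : ContDiffAt ℝ 2 (f ∘ sphereProj ‖x‖) (‖x‖⁻¹ • x) :=
    (contDiff_infty.1 hf 2).contDiffAt.comp _ (contDiffAt_sphereProj _ hp)
  have key := norm_sq_smul_laplacian h2
  rw [hpn, one_pow, one_smul] at key
  have hmain : sphereLaplaceBeltrami (fun θ => f (‖x‖ • θ)) (‖x‖⁻¹ • x)
      = (Laplacian.laplacian (f ∘ sphereProj ‖x‖)) (‖x‖⁻¹ • x) := rfl
  rw [sphericalLaplacian, hmain, key]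
  congr 1
  have h0 : eulerQuad (f ∘ sphereProj ‖x‖) (‖x‖⁻¹ • x) = 0 := by
    rw [eulerQuad, linDeriv_congr hE, hE.eq_of_nhds]
    simp [linDeriv_apply]
  rw [h0, zero_add, rotCasimir, rotCasimir]
  refine Finset.sum_congr rfl fun i _ => ?_
  rw [linDeriv_congr (hL i), linDeriv_comp_sphereProj ((hf.linDeriv _).differentiable (by simp))
    _ hp (inner_rotGen_self i), Function.comp_apply, hproj]

/-! ### Test functions away from the origin and the weighted inner product -/

namespace IsPuncturedTestFunction

variable {n : ℕ} {f g : EuclideanSpace ℝ (Fin n) → ℂ}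

theorem linDeriv (hf : IsPuncturedTestFunction f)
    (A : EuclideanSpace ℝ (Fin n) →L[ℝ] EuclideanSpace ℝ (Fin n)) :
    IsPuncturedTestFunction (linDeriv A f) where
  contDiff := hf.contDiff.linDeriv A
  hasCompactSupport := hf.hasCompactSupport.mono' (support_linDeriv_subset A f)
  zero_notMem_tsupport h := hf.zero_notMem_tsupport (tsupport_linDeriv_subset A f h)

theorem add (hf : IsPuncturedTestFunction f) (hg : IsPuncturedTestFunction g) :
    IsPuncturedTestFunction (f + g) where
  contDiff := hf.contDiff.add hg.contDiff
  hasCompactSupport := hf.hasCompactSupport.add hg.hasCompactSupport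
  zero_notMem_tsupport h :=
    (tsupport_add f g h).elim hf.zero_notMem_tsupport hg.zero_notMem_tsupport

theorem const_smul (c : ℝ) (hf : IsPuncturedTestFunction f) :
    IsPuncturedTestFunction (c • f) where
  contDiff := contDiff_const.smul hf.contDiff
  hasCompactSupport := hf.hasCompactSupport.smul_left (f := fun _ => c)
  zero_notMem_tsupport h :=
    hf.zero_notMem_tsupport (tsupport_smul_subset_right (fun _ => c) f h)

/-- Multiplication by a weight that is smooth away from the origin. -/
theorem weight_smul (hf : IsPuncturedTestFunction f) {w : EuclideanSpace ℝ (Fin n) → ℝ}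
    (hw : ∀ x, x ≠ 0 → ContDiffAt ℝ ∞ w x) :
    IsPuncturedTestFunction fun x => w x • f x where
  contDiff := by
    rw [contDiff_iff_contDiffAt]
    intro x
    by_cases hx : x ∈ tsupport f
    · exact (hw x fun h => hf.zero_notMem_tsupport (h ▸ hx)).smul hf.contDiff.contDiffAt
    · have : (fun x => w x • f x) =ᶠ[nhds x] fun _ => 0 :=
        (notMem_tsupport_iff_eventuallyEq.mp hx).mono fun y hy => by simp [hy]
      exact contDiffAt_const.congr_of_eventuallyEq this
  hasCompactSupport := hf.hasCompactSupport.smul_left (f := w)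
  zero_notMem_tsupport h := hf.zero_notMem_tsupport (tsupport_smul_subset_right w f h)

theorem inv_norm_sq_smul (hf : IsPuncturedTestFunction f) :
    IsPuncturedTestFunction fun x => (‖x‖ ^ 2)⁻¹ • f x :=
  hf.weight_smul fun _ hx => contDiffAt_inv_norm_sq hx

theorem memLp (hf : IsPuncturedTestFunction f) : MemLp f 2 volume :=
  hf.contDiff.continuous.memLp_of_hasCompactSupport hf.hasCompactSupport

theorem integrable_inner (hf : IsPuncturedTestFunction f) (hg : IsPuncturedTestFunction g) :
    Integrable fun x => inner ℝ (f x) (g x) :=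
  (hf.contDiff.continuous.inner hg.contDiff.continuous).integrable_of_hasCompactSupport
    (hf.hasCompactSupport.mono fun x hx h => hx (by simp [h]))

theorem linDeriv_inv_norm_sq_smul (hf : IsPuncturedTestFunction f)
    {A : EuclideanSpace ℝ (Fin n) →L[ℝ] EuclideanSpace ℝ (Fin n)} {a : ℝ}
    (hA : ∀ x, inner ℝ x (A x) = a * ‖x‖ ^ 2) (x : EuclideanSpace ℝ (Fin n)) :
    EvansLewis.linDeriv A (fun y => (‖y‖ ^ 2)⁻¹ • f y) x
      = (-2 * a) • ((‖x‖ ^ 2)⁻¹ • f x) + (‖x‖ ^ 2)⁻¹ • EvansLewis.linDeriv A f x := by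
  -- At the origin both sides vanish, since A 0 = 0 and the weight is 0⁻¹ = 0.
  by_cases hx : x = 0
  · subst hx
    simp [linDeriv_apply]
  · have hn : ‖x‖ ≠ 0 := norm_ne_zero_iff.mpr hx
    rw [linDeriv_smul ((contDiffAt_inv_norm_sq hx (n := 1)).differentiableAt (by norm_num))
      (hf.contDiff.differentiable (by simp) x), linDeriv_inv_norm_sq hx, hA, smul_smul]
    congr 2
    field_simp

end IsPuncturedTestFunction

/-- The real vector space of test functions supported away from the origin. -/
noncomputable def puncturedTest (n : ℕ) : Submodule ℝ (EuclideanSpace ℝ (Fin n) → ℂ) where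
  carrier := {f | IsPuncturedTestFunction f}
  add_mem' hf hg := IsPuncturedTestFunction.add hf hg
  zero_mem' :=
    { contDiff := contDiff_const
      hasCompactSupport := HasCompactSupport.zero
      zero_notMem_tsupport := by simp [tsupport] }
  smul_mem' c _ hf := IsPuncturedTestFunction.const_smul c hf

namespace puncturedTest

variable {n : ℕ}

theorem isTest (f : puncturedTest n) : IsPuncturedTestFunction (f : EuclideanSpace ℝ (Fin n) → ℂ) :=
  f.2

theorem differentiable (f : puncturedTest n) :
    Differentiable ℝ (f : EuclideanSpace ℝ (Fin n) → ℂ) :=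
  (isTest f).contDiff.differentiable (by simp)

/-- The derivative along a linear vector field as an operator on test functions. -/
noncomputable def deriv (A : EuclideanSpace ℝ (Fin n) →L[ℝ] EuclideanSpace ℝ (Fin n)) :
    puncturedTest n →ₗ[ℝ] puncturedTest n where
  toFun f := ⟨linDeriv A f, (isTest f).linDeriv A⟩
  map_add' f g := Subtype.ext <| funext fun x =>
    linDeriv_add (differentiable f x) (differentiable g x)
  map_smul' c f := Subtype.ext <| funext fun x => linDeriv_const_smul c (differentiable f x)

@[simp]
theorem coe_deriv (A : EuclideanSpace ℝ (Fin n) →L[ℝ] EuclideanSpace ℝ (Fin n))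
    (f : puncturedTest n) : (deriv A f : EuclideanSpace ℝ (Fin n) → ℂ) = linDeriv A f := rfl

theorem deriv_comm (A B : EuclideanSpace ℝ (Fin n) →L[ℝ] EuclideanSpace ℝ (Fin n))
    (f : puncturedTest n) :
    deriv A (deriv B f) - deriv B (deriv A f) = deriv (B.comp A - A.comp B) f :=
  Subtype.ext <| funext fun _ => linDeriv_comm (contDiff_infty.1 (isTest f).contDiff 2).contDiffAt

theorem deriv_neg (A : EuclideanSpace ℝ (Fin n) →L[ℝ] EuclideanSpace ℝ (Fin n))
    (f : puncturedTest n) : deriv (-A) f = -deriv A f :=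
  Subtype.ext <| funext fun x => by simp [linDeriv_apply]

theorem integrable_weighted (f g : puncturedTest n) :
    Integrable fun x => inner ℝ ((‖x‖ ^ 2)⁻¹ • f.1 x) ((‖x‖ ^ 2)⁻¹ • g.1 x) :=
  (isTest f).inv_norm_sq_smul.integrable_inner (isTest g).inv_norm_sq_smul

/-- The real part of the inner product of `L²(|x|⁻⁴ dx)`. -/
noncomputable def weightedInner : puncturedTest n →ₗ[ℝ] puncturedTest n →ₗ[ℝ] ℝ :=
  LinearMap.mk₂ ℝ
    (fun f g => ∫ x, inner ℝ ((‖x‖ ^ 2)⁻¹ • f.1 x) ((‖x‖ ^ 2)⁻¹ • g.1 x))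
    (fun f₁ f₂ g => by
      rw [← integral_add (integrable_weighted f₁ g) (integrable_weighted f₂ g)]
      simp only [Submodule.coe_add, Pi.add_apply, smul_add, inner_add_left])
    (fun c f g => by
      rw [smul_eq_mul, ← integral_const_mul]
      simp only [Submodule.coe_smul, Pi.smul_apply, smul_comm _ c, real_inner_smul_left _ _ c])
    (fun f g₁ g₂ => by
      rw [← integral_add (integrable_weighted f g₁) (integrable_weighted f g₂)]
      simp only [Submodule.coe_add, Pi.add_apply, smul_add, inner_add_right])
    (fun c f g => by
      rw [smul_eq_mul, ← integral_const_mul]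
      simp only [Submodule.coe_smul, Pi.smul_apply, smul_comm _ c, real_inner_smul_right _ _ c])

theorem weightedInner_apply (f g : puncturedTest n) :
    weightedInner f g = ∫ x, inner ℝ ((‖x‖ ^ 2)⁻¹ • f.1 x) ((‖x‖ ^ 2)⁻¹ • g.1 x) := rfl

theorem weightedInner_comm (f g : puncturedTest n) : weightedInner f g = weightedInner g f := by
  simp only [weightedInner_apply]
  exact integral_congr_ae (.of_forall fun _ => real_inner_comm _ _)

theorem weightedInner_self (f : puncturedTest n) :
    weightedInner f f = ∫ x, ‖(‖x‖ ^ 2)⁻¹ • f.1 x‖ ^ 2 := by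
  simp only [weightedInner_apply, real_inner_self_eq_norm_sq]

theorem weightedInner_self_nonneg (f : puncturedTest n) : 0 ≤ weightedInner f f := by
  rw [weightedInner_self]
  positivity

theorem integrable_norm_sq (f : puncturedTest n) :
    Integrable fun x => ‖(‖x‖ ^ 2)⁻¹ • f.1 x‖ ^ 2 := by
  simpa only [real_inner_self_eq_norm_sq] using integrable_weighted f f

/-- The term 4a comes from differentiating the weight |x|⁻⁴, the trace from the divergence theorem.
Rotations have a = 0 and trace 0; the Euler field gives 4 − 3 = 1, whence the shift by 1/2 in
`dilation`. -/
theorem weightedInner_deriv {A : EuclideanSpace ℝ (Fin n) →L[ℝ] EuclideanSpace ℝ (Fin n)} {a : ℝ}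
    (hA : ∀ x, inner ℝ x (A x) = a * ‖x‖ ^ 2) (f g : puncturedTest n) :
    weightedInner (deriv A f) g + weightedInner f (deriv A g)
      = (4 * a - ∑ i, A (EuclideanSpace.single i 1) i) * weightedInner f g := by
  have hf := (isTest f).inv_norm_sq_smul
  have hg := (isTest g).inv_norm_sq_smul
  have hdiv := integral_linDeriv A
    ((hf.contDiff.inner ℝ hg.contDiff).of_le (m := 1) (by simp))
    (hf.hasCompactSupport.mono fun x hx h => hx (by simp [h]))
  have hpt : ∀ x, linDeriv A
      (fun x => inner ℝ ((‖x‖ ^ 2)⁻¹ • f.1 x) ((‖x‖ ^ 2)⁻¹ • g.1 x)) x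
      = (inner ℝ ((‖x‖ ^ 2)⁻¹ • (deriv A f).1 x) ((‖x‖ ^ 2)⁻¹ • g.1 x)
        + inner ℝ ((‖x‖ ^ 2)⁻¹ • f.1 x) ((‖x‖ ^ 2)⁻¹ • (deriv A g).1 x))
        - 4 * a * inner ℝ ((‖x‖ ^ 2)⁻¹ • f.1 x) ((‖x‖ ^ 2)⁻¹ • g.1 x) := by
    intro x
    rw [linDeriv_inner (hf.contDiff.differentiable (by simp) x)
      (hg.contDiff.differentiable (by simp) x), (isTest f).linDeriv_inv_norm_sq_smul hA,
      (isTest g).linDeriv_inv_norm_sq_smul hA, inner_add_left, inner_add_right,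
      real_inner_smul_left, real_inner_smul_right _ _ (-2 * a), coe_deriv, coe_deriv]
    ring
  simp_rw [hpt] at hdiv
  rw [integral_sub ((integrable_weighted _ _).fun_add (integrable_weighted _ _))
    ((integrable_weighted _ _).const_mul _),
    integral_add (integrable_weighted _ _) (integrable_weighted _ _), integral_const_mul] at hdiv
  simp only [weightedInner_apply]
  linarith

end puncturedTest

/-! ### Passage from `l2Norm` to the weighted inner product -/

theorem ae_ne_zero {n : ℕ} [NeZero n] : ∀ᵐ x : EuclideanSpace ℝ (Fin n), x ≠ 0 := by
  have : Nontrivial (EuclideanSpace ℝ (Fin n)) := inferInstance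
  exact Measure.ae_ne volume 0

theorem memLp_of_eq_off_zero {n : ℕ} [NeZero n] {g : EuclideanSpace ℝ (Fin n) → ℂ}
    (f : puncturedTest n) (h : ∀ x, x ≠ 0 → g x = (‖x‖ ^ 2)⁻¹ • f.1 x) : MemLp g 2 volume :=
  (memLp_congr_ae (ae_ne_zero.mono h)).mpr (puncturedTest.isTest f).inv_norm_sq_smul.memLp

theorem l2Norm_sq_of_eq_off_zero {n : ℕ} [NeZero n] {g : EuclideanSpace ℝ (Fin n) → ℂ}
    (f : puncturedTest n) (h : ∀ x, x ≠ 0 → g x = (‖x‖ ^ 2)⁻¹ • f.1 x) :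
    l2Norm g ^ 2 = puncturedTest.weightedInner f f := by
  rw [l2Norm, eLpNorm_congr_ae (ae_ne_zero.mono h),
    (puncturedTest.isTest f).inv_norm_sq_smul.memLp.eLpNorm_eq_integral_rpow_norm
      (by norm_num) (by norm_num), puncturedTest.weightedInner_self]
  have hnn : 0 ≤ ∫ x, ‖(‖x‖ ^ 2)⁻¹ • f.1 x‖ ^ 2 := by positivity
  simp only [ENNReal.toReal_ofNat, Real.rpow_ofNat]
  rw [ENNReal.toReal_ofReal (by positivity), ← Real.rpow_natCast, ← Real.rpow_mul hnn]
  norm_num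

/-! ### Pointwise Bochner-type inequality -/

/-- With q = g × x and s = |x|², the matrix h − q xᵀ/s is annihilated by x on both sides, so it
lives on the tangent plane; a 2 × 2 matrix of trace t has squared norm at least t²/2. The removed
part is orthogonal to it and has squared norm |q|²/s = |g|². -/
theorem sum_sq_ge_of_tangential {x g : Fin 3 → ℝ} {h : Fin 3 → Fin 3 → ℝ} (hx : x ≠ 0)
    (hg : ∑ i, x i * g i = 0) (hleft : ∀ j, ∑ i, x i * h i j = 0)
    (hright : ∀ i, ∑ j, x j * h i j = x (i + 2) * g (i + 1) - x (i + 1) * g (i + 2)) :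
    (∑ i, h i i) ^ 2 / 2 + ∑ i, g i ^ 2 ≤ ∑ i, ∑ j, h i j ^ 2 := by
  set s : ℝ := ∑ i, x i ^ 2 with hs
  set t : ℝ := ∑ i, h i i with ht
  let q : Fin 3 → ℝ := fun i => x (i + 2) * g (i + 1) - x (i + 1) * g (i + 2)
  have hspos : 0 < s := by
    obtain ⟨i, hi⟩ := Function.ne_iff.mp hx
    exact Finset.sum_pos' (fun i _ => sq_nonneg _) ⟨i, Finset.mem_univ i, by
      have : x i ≠ 0 := hi
      positivity⟩
  have hq : ∑ i, q i ^ 2 = s * ∑ i, g i ^ 2 := by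
    simp only [hs, q, Fin.sum_univ_three] at hg ⊢
    simp only [Fin.reduceAdd, zero_add] at hg ⊢
    linear_combination (-(x 0 * g 0 + x 1 * g 1 + x 2 * g 2)) * hg
  have hxq : ∑ i, x i * q i = 0 := by
    simp only [q, Fin.sum_univ_three]
    simp only [Fin.reduceAdd, zero_add]
    ring
  -- The summands are the entries of the trace-free tangential part of h, multiplied by s to avoid
  -- division.
  have hsq : 0 ≤ ∑ i, ∑ j,
      (s * h i j - q i * x j - t / 2 * ((if i = j then s else 0) - x i * x j)) ^ 2 := by
    positivity
  have hid : ∑ i, ∑ j,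
      (s * h i j - q i * x j - t / 2 * ((if i = j then s else 0) - x i * x j)) ^ 2
      = s ^ 2 * (∑ i, ∑ j, h i j ^ 2 - t ^ 2 / 2 - ∑ i, g i ^ 2) := by
    have hr : ∀ i, ∑ j, x j * h i j = q i := hright
    have e0 := hleft 0
    have e1 := hleft 1
    have e2 := hleft 2
    have r0 := hr 0
    have r1 := hr 1
    have r2 := hr 2
    clear_value q
    rw [hs, ht] at *
    simp only [Fin.sum_univ_three] at *
    simp only [Fin.reduceEq, if_true, if_false]
    linear_combination (-2 * (x 0 ^ 2 + x 1 ^ 2 + x 2 ^ 2)) * (q 0 * r0 + q 1 * r1 + q 2 * r2)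
      + (x 0 ^ 2 + x 1 ^ 2 + x 2 ^ 2) * (h 0 0 + h 1 1 + h 2 2) * (x 0 * e0 + x 1 * e1 + x 2 * e2)
      - (x 0 ^ 2 + x 1 ^ 2 + x 2 ^ 2) * hq
  have := hid ▸ hsq
  have h2 := nonneg_of_mul_nonneg_right this (by positivity)
  linarith

theorem norm_rotCasimir_sq_le {f : EuclideanSpace ℝ (Fin 3) → ℂ} {x : EuclideanSpace ℝ (Fin 3)}
    (hf : ContDiff ℝ ∞ f) (hx : x ≠ 0) :
    ‖rotCasimir f x‖ ^ 2 / 2 + ∑ i, ‖linDeriv (rotGen i) f x‖ ^ 2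
      ≤ ∑ i, ∑ j, ‖linDeriv (rotGen i) (linDeriv (rotGen j) f) x‖ ^ 2 := by
  have hx' : (x : Fin 3 → ℝ) ≠ 0 := fun h => hx (by ext i; simpa using congrFun h i)
  have hsum : ∀ (m : EuclideanSpace ℝ (Fin 3) →L[ℝ] ℂ) (v : Fin 3 → EuclideanSpace ℝ (Fin 3)),
      ∑ i, x i • m (v i) = m (∑ i, x i • v i) := fun m v => by simp [map_sum]
  have hg : ∑ i, x i • linDeriv (rotGen i) f x = 0 := by
    simp only [linDeriv_apply, hsum, sum_smul_rotGen, map_zero]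
  have hleft : ∀ j, ∑ i, x i • linDeriv (rotGen i) (linDeriv (rotGen j) f) x = 0 := fun j =>
    (hsum (fderiv ℝ (linDeriv (rotGen j) f) x) fun i => rotGen i x).trans
      (by rw [sum_smul_rotGen, map_zero])
  have hright : ∀ i, ∑ j, x j • linDeriv (rotGen i) (linDeriv (rotGen j) f) x
      = x (i + 2) • linDeriv (rotGen (i + 1)) f x - x (i + 1) • linDeriv (rotGen (i + 2)) f x := by
    intro i
    -- The Hessian terms drop out because ∑ x_j (e_j × x) = 0; only the derivatives of the
    -- coefficients of R_j remain.
    simp only [linDeriv_linDeriv_apply (contDiff_infty.1 hf 2).contDiffAt, smul_add,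
      Finset.sum_add_distrib, hsum, sum_smul_rotGen, map_zero, zero_add,
      sum_smul_rotGen_comp, linDeriv_apply]
    rw [map_sub, map_smul, map_smul]
  -- The real inequality is applied to real and imaginary parts separately, then added.
  have key : ∀ l : ℂ →ₗ[ℝ] ℝ,
      (l (rotCasimir f x)) ^ 2 / 2 + ∑ i, l (linDeriv (rotGen i) f x) ^ 2
        ≤ ∑ i, ∑ j, l (linDeriv (rotGen i) (linDeriv (rotGen j) f) x) ^ 2 := by
    intro l
    rw [rotCasimir, map_sum]
    refine sum_sq_ge_of_tangential (x := x.ofLp) (g := fun i => l (linDeriv (rotGen i) f x))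
      (h := fun i j => l (linDeriv (rotGen i) (linDeriv (rotGen j) f) x)) hx' ?_
      (fun j => ?_) (fun i => ?_)
    · simpa only [map_sum, map_smul, smul_eq_mul, map_zero] using congrArg l hg
    · simpa only [map_sum, map_smul, smul_eq_mul, map_zero] using congrArg l (hleft j)
    · simpa only [map_sum, map_smul, smul_eq_mul, map_sub] using congrArg l (hright i)
  have hz : ∀ z : ℂ, ‖z‖ ^ 2 = Complex.reLm z ^ 2 + Complex.imLm z ^ 2 := fun z => by
    rw [Complex.sq_norm, Complex.normSq_apply]; simp [sq]
  simp only [hz, Finset.sum_add_distrib]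
  linarith [key Complex.reLm, key Complex.imLm]

/-! ### Operator algebra and the spectral gap -/

namespace puncturedTest

/-- The infinitesimal rotations acting on test functions. -/
noncomputable abbrev rot (i : Fin 3) : puncturedTest 3 →ₗ[ℝ] puncturedTest 3 := deriv (rotGen i)

/-- The shifted Euler field `x · ∇ - 1/2`, which is antisymmetric in `L²(|x|⁻⁴ dx)`. -/
noncomputable def dilation : puncturedTest 3 →ₗ[ℝ] puncturedTest 3 :=
  deriv (.id ℝ _) - (1 / 2 : ℝ) • LinearMap.id

/-- The spherical Laplacian, times `|x|²`, on test functions. -/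
noncomputable def casimir : puncturedTest 3 →ₗ[ℝ] puncturedTest 3 := ∑ i, rot i ∘ₗ rot i

/-- The radial Laplacian, times `|x|²`, on test functions. -/
noncomputable def euler : puncturedTest 3 →ₗ[ℝ] puncturedTest 3 :=
  deriv (.id ℝ _) ∘ₗ deriv (.id ℝ _) + deriv (.id ℝ _)

theorem casimir_apply (f : puncturedTest 3) : casimir f = ∑ i, rot i (rot i f) := by
  simp [casimir]

theorem coe_casimir (f : puncturedTest 3) (x : EuclideanSpace ℝ (Fin 3)) :
    (casimir f).1 x = rotCasimir f.1 x := by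
  simp [casimir_apply, rotCasimir]

theorem coe_euler (f : puncturedTest 3) (x : EuclideanSpace ℝ (Fin 3)) :
    (euler f).1 x = eulerQuad f.1 x := by
  simp [euler, eulerQuad]

theorem euler_eq (f : puncturedTest 3) :
    euler f = dilation (dilation f) + (2 : ℝ) • dilation f + (3 / 4 : ℝ) • f := by
  simp only [euler, dilation, LinearMap.add_apply, LinearMap.comp_apply, LinearMap.sub_apply,
    LinearMap.smul_apply, LinearMap.id_apply, map_sub, map_smul]
  module

theorem weightedInner_rot (i : Fin 3) (f g : puncturedTest 3) :
    weightedInner (rot i f) g = -weightedInner f (rot i g) := by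
  have h := weightedInner_deriv (A := rotGen i) (a := 0)
    (fun x => by rw [inner_rotGen_self, zero_mul]) f g
  rw [trace_rotGen] at h
  linarith

theorem weightedInner_dilation (f g : puncturedTest 3) :
    weightedInner (dilation f) g = -weightedInner f (dilation g) := by
  have h := weightedInner_deriv (n := 3) (A := .id ℝ _) (a := 1)
    (fun x => by simp) f g
  simp only [dilation, LinearMap.sub_apply, LinearMap.smul_apply, LinearMap.id_apply, map_sub,
    map_smul, smul_eq_mul]
  norm_num at h
  linarith

theorem rot_dilation (i : Fin 3) (f : puncturedTest 3) :
    rot i (dilation f) = dilation (rot i f) := by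
  have h := deriv_comm (rotGen i) (.id ℝ _) f
  have h0 : (ContinuousLinearMap.id ℝ (EuclideanSpace ℝ (Fin 3))).comp (rotGen i)
      - (rotGen i).comp (.id ℝ _) = 0 := by ext; simp
  have h1 : deriv (0 : EuclideanSpace ℝ (Fin 3) →L[ℝ] EuclideanSpace ℝ (Fin 3)) f = 0 :=
    Subtype.ext <| funext fun x => by simp [linDeriv_apply]
  rw [h0, h1, sub_eq_zero] at h
  simp only [dilation, LinearMap.sub_apply, LinearMap.smul_apply, LinearMap.id_apply, map_sub,
    map_smul, h]

theorem rot_euler (i : Fin 3) (f : puncturedTest 3) : rot i (euler f) = euler (rot i f) := by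
  simp only [euler_eq, map_add, map_smul, rot_dilation]

theorem rot_commutator (i : Fin 3) (f : puncturedTest 3) :
    rot i (rot (i + 1) f) = rot (i + 1) (rot i f) - rot (i + 2) f := by
  have h := deriv_comm (rotGen i) (rotGen (i + 1)) f
  rw [rotGen_commutator, deriv_neg] at h
  rw [sub_eq_iff_eq_add] at h
  rw [rot, rot, rot, h]
  abel

theorem rot_casimir (j : Fin 3) (f : puncturedTest 3) :
    rot j (casimir f) = casimir (rot j f) := by
  -- These relations rewrite every word in the rotations to decreasing index order, after which both
  -- sides agree by linear algebra.
  have c0 : ∀ f, rot 0 (rot 1 f) = rot 1 (rot 0 f) - rot 2 f := rot_commutator 0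
  have c1 : ∀ f, rot 1 (rot 2 f) = rot 2 (rot 1 f) - rot 0 f := rot_commutator 1
  have c2 : ∀ f, rot 0 (rot 2 f) = rot 2 (rot 0 f) + rot 1 f := fun f => by
    rw [show rot 2 (rot 0 f) = rot 0 (rot 2 f) - rot 1 f from rot_commutator 2 f]; abel
  simp only [casimir_apply, Fin.sum_univ_three, map_add]
  fin_cases j <;>
    simp only [Fin.zero_eta, Fin.mk_one, Fin.reduceFinMk, c0, c1, c2, map_add, map_sub] <;> abel

theorem weightedInner_casimir (f g : puncturedTest 3) :
    weightedInner (casimir f) g = -∑ i, weightedInner (rot i f) (rot i g) := by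
  rw [casimir_apply, map_sum, LinearMap.sum_apply, ← Finset.sum_neg_distrib]
  exact Finset.sum_congr rfl fun i _ => weightedInner_rot i _ _

/-- The `L²` norm of the full second rotational derivative equals that of the Casimir. -/
theorem sum_weightedInner_rot_rot (f : puncturedTest 3) :
    ∑ i, ∑ j, weightedInner (rot i (rot j f)) (rot i (rot j f))
      = weightedInner (casimir f) (casimir f) := by
  rw [Finset.sum_comm]
  have h : ∀ j, ∑ i, weightedInner (rot i (rot j f)) (rot i (rot j f))
      = weightedInner (casimir f) (rot j (rot j f)) := fun j => by
    rw [← neg_eq_iff_eq_neg.mpr (weightedInner_casimir (rot j f) (rot j f)), ← rot_casimir,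
      weightedInner_rot, neg_neg]
  rw [Finset.sum_congr rfl fun j _ => h j, ← map_sum, ← casimir_apply]

/-- The spectral gap of the sphere: the lowest nonzero eigenvalue of `-Δ_𝕊` is at least `2`,
stated as a Lichnerowicz-type integral inequality. -/
theorem two_mul_sum_weightedInner_rot_le (f : puncturedTest 3) :
    2 * ∑ i, weightedInner (rot i f) (rot i f) ≤ weightedInner (casimir f) (casimir f) := by
  have h : weightedInner (casimir f) (casimir f) / 2 + ∑ i, weightedInner (rot i f) (rot i f)
      ≤ ∑ i, ∑ j, weightedInner (rot i (rot j f)) (rot i (rot j f)) := by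
    simp only [weightedInner_self]
    rw [← integral_div, ← integral_finsetSum _ fun i _ => integrable_norm_sq (rot i f),
      ← integral_add ((integrable_norm_sq _).div_const 2)
        (integrable_finsetSum _ fun i _ => integrable_norm_sq (rot i f)),
      Finset.sum_congr rfl fun i _ =>
        (integral_finsetSum _ fun j _ => integrable_norm_sq (rot i (rot j f))).symm,
      ← integral_finsetSum _ fun i _ =>
        integrable_finsetSum _ fun j _ => integrable_norm_sq (rot i (rot j f))]
    refine integral_mono
      (((integrable_norm_sq _).div_const 2).add
        (integrable_finsetSum _ fun i _ => integrable_norm_sq (rot i f)))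
      (integrable_finsetSum _ fun i _ =>
        integrable_finsetSum _ fun j _ => integrable_norm_sq (rot i (rot j f))) fun x => ?_
    simp only [norm_smul, mul_pow, ← Finset.mul_sum, mul_div_assoc, ← mul_add, coe_casimir]
    -- At the origin the weight is 0 by convention, so both sides vanish.
    rcases eq_or_ne x 0 with rfl | hx
    · simp
    · exact mul_le_mul_of_nonneg_left (norm_rotCasimir_sq_le (isTest f).contDiff hx) (by positivity)
  rw [sum_weightedInner_rot_rot] at h
  linarith

/-! ### Hardy and Rellich bounds, and the two endpoint inequalities -/

theorem weightedInner_dilation_self (f : puncturedTest 3) : weightedInner (dilation f) f = 0 := by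
  linarith [weightedInner_dilation f f, weightedInner_comm f (dilation f)]

theorem weightedInner_euler_self (f : puncturedTest 3) :
    weightedInner (euler f) f
      = 3 / 4 * weightedInner f f - weightedInner (dilation f) (dilation f) := by
  rw [euler_eq]
  simp only [map_add, map_smul, LinearMap.add_apply, LinearMap.smul_apply, smul_eq_mul,
    weightedInner_dilation_self, weightedInner_dilation (dilation f) f]
  ring

/-- The Rellich inequality for the radial Laplacian. -/
theorem nine_sixteenths_mul_weightedInner_le (f : puncturedTest 3) :
    9 / 16 * weightedInner f f ≤ weightedInner (euler f) (euler f) := by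
  have h1 := weightedInner_dilation_self f
  have h2 := weightedInner_dilation_self (dilation f)
  have h3 := weightedInner_dilation (dilation f) f
  -- Expanding ‖(D² + 2D + 3/4)f‖²: the odd pairings vanish and 2 · ¾⟨D²f, f⟩ = −(3/2)‖Df‖², so the
  -- middle coefficient is 4 − 3/2 = 5/2.
  have h4 : weightedInner (euler f) (euler f)
      = weightedInner (dilation (dilation f)) (dilation (dilation f))
        + 5 / 2 * weightedInner (dilation f) (dilation f) + 9 / 16 * weightedInner f f := by
    rw [euler_eq]
    simp only [map_add, map_smul, LinearMap.add_apply, LinearMap.smul_apply, smul_eq_mul,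
      weightedInner_comm f (dilation f), weightedInner_comm f (dilation (dilation f)),
      weightedInner_comm (dilation f) (dilation (dilation f)), h1, h2, h3]
    ring
  linarith [weightedInner_self_nonneg (dilation f),
    weightedInner_self_nonneg (dilation (dilation f))]

/-- The Hardy inequality for the cross term. -/
theorem weightedInner_euler_casimir_ge (f : puncturedTest 3) :
    -(3 / 4) * ∑ i, weightedInner (rot i f) (rot i f) ≤ weightedInner (euler f) (casimir f) := by
  have h : weightedInner (euler f) (casimir f)
      = ∑ i, (weightedInner (dilation (rot i f)) (dilation (rot i f))
        - 3 / 4 * weightedInner (rot i f) (rot i f)) := by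
    rw [weightedInner_comm, weightedInner_casimir, ← Finset.sum_neg_distrib]
    refine Finset.sum_congr rfl fun i _ => ?_
    rw [rot_euler, weightedInner_comm, weightedInner_euler_self]
    ring
  rw [h, Finset.mul_sum]
  exact Finset.sum_le_sum fun i _ => by linarith [weightedInner_self_nonneg (dilation (rot i f))]

theorem weightedInner_add_self (f g : puncturedTest 3) :
    weightedInner (f + g) (f + g)
      = weightedInner f f + 2 * weightedInner f g + weightedInner g g := by
  simp only [map_add, LinearMap.add_apply, weightedInner_comm g f]
  ring

theorem weightedInner_laplacian_ge (f : puncturedTest 3) :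
    weightedInner (euler f) (euler f) + 1 / 4 * weightedInner (casimir f) (casimir f)
      ≤ weightedInner (euler f + casimir f) (euler f + casimir f) := by
  rw [weightedInner_add_self]
  linarith [weightedInner_euler_casimir_ge f, two_mul_sum_weightedInner_rot_le f]

theorem weightedInner_laplacian_ge_casimir (f : puncturedTest 3) :
    25 / 64 * weightedInner (casimir f) (casimir f)
      ≤ weightedInner (euler f + casimir f) (euler f + casimir f) := by
  -- The shift 2 is the first nonzero eigenvalue of −C. Nonnegativity gives ‖f‖² ≥ G − ¼‖Cf‖²; fed
  -- into the Rellich term this leaves (55/64)‖Cf‖² − (15/16)G, which the gap turns into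
  -- (25/64)‖Cf‖².
  have h := weightedInner_self_nonneg (casimir f + (2 : ℝ) • f)
  rw [weightedInner_add_self] at h
  simp only [map_smul, LinearMap.smul_apply, smul_eq_mul, weightedInner_casimir f f] at h
  rw [weightedInner_add_self]
  linarith [weightedInner_euler_casimir_ge f, two_mul_sum_weightedInner_rot_le f,
    nine_sixteenths_mul_weightedInner_le f]

/-! ### Identification of the three operators, and strictness -/

theorem laplacian_eq (f : puncturedTest 3) {x : EuclideanSpace ℝ (Fin 3)} (hx : x ≠ 0) :
    (Laplacian.laplacian f.1) x = (‖x‖ ^ 2)⁻¹ • (euler f + casimir f).1 x := by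
  rw [laplacian_eq_of_ne_zero (contDiff_infty.1 (isTest f).contDiff 2).contDiffAt hx,
    ← coe_euler, ← coe_casimir]
  rfl

theorem radialLaplacian_eq (f : puncturedTest 3) {x : EuclideanSpace ℝ (Fin 3)} (hx : x ≠ 0) :
    radialLaplacian f.1 x = (‖x‖ ^ 2)⁻¹ • (euler f).1 x := by
  rw [radialLaplacian_eq_of_ne_zero (isTest f).contDiff hx, ← coe_euler]

theorem sphericalLaplacian_eq (f : puncturedTest 3) {x : EuclideanSpace ℝ (Fin 3)} (hx : x ≠ 0) :
    sphericalLaplacian f.1 x = (‖x‖ ^ 2)⁻¹ • (casimir f).1 x := by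
  rw [sphericalLaplacian_eq_of_ne_zero (isTest f).contDiff hx, ← coe_casimir]

theorem weightedInner_self_pos {f : puncturedTest 3} {p : EuclideanSpace ℝ (Fin 3)} (hp : p ≠ 0)
    (hf : f.1 p ≠ 0) : 0 < weightedInner f f := by
  rw [weightedInner_self]
  refine Continuous.integral_pos_of_hasCompactSupport_nonneg_nonzero (x := p)
    ((isTest f).inv_norm_sq_smul.contDiff.continuous.norm.pow 2)
    ((isTest f).inv_norm_sq_smul.hasCompactSupport.mono fun x hx h => hx (by simp [h]))
    (fun x => by positivity) ?_
  simpa [norm_smul] using ⟨hp, hf⟩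

/-- A coordinate function is a first spherical harmonic times |x|, so C multiplies it by −2. Near a
unit vector a bump of outer radius 1/2 cuts it off without meeting the origin or changing it near
the centre. -/
theorem exists_casimir_ne_zero :
    ∃ f : puncturedTest 3, ∃ p : EuclideanSpace ℝ (Fin 3), p ≠ 0 ∧ (casimir f).1 p ≠ 0 := by
  let p : EuclideanSpace ℝ (Fin 3) := EuclideanSpace.single 0 1
  have hpn : ‖p‖ = 1 := by simp [p]
  let b : ContDiffBump p := ⟨1 / 4, 1 / 2, by norm_num, by norm_num⟩
  let l : EuclideanSpace ℝ (Fin 3) →L[ℝ] ℂ := Complex.ofRealCLM ∘L EuclideanSpace.proj (𝕜 := ℝ) 0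
  have htest : IsPuncturedTestFunction fun x => b x • l x :=
    { contDiff := b.contDiff.smul l.contDiff
      hasCompactSupport := b.hasCompactSupport.smul_right
      zero_notMem_tsupport := fun h => by
        have := tsupport_smul_subset_left b l h
        rw [b.tsupport_eq, Metric.mem_closedBall, dist_comm, dist_zero_right, hpn] at this
        norm_num [b] at this }
  refine ⟨⟨_, htest⟩, p, fun h => by simp [h] at hpn, ?_⟩
  have hl : (fun x => b x • l x) =ᶠ[nhds p] l :=
    b.eventuallyEq_one.mono fun x hx => by simp [hx]
  have hlin : ∀ (A : EuclideanSpace ℝ (Fin 3) →L[ℝ] EuclideanSpace ℝ (Fin 3))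
      (m : EuclideanSpace ℝ (Fin 3) →L[ℝ] ℂ), linDeriv A m = m ∘L A := fun A m => by
    ext x; simp [linDeriv_apply]
  have hsum : rotCasimir (fun x => b x • l x) p = ∑ i, l (rotGen i (rotGen i p)) := by
    rw [rotCasimir]
    refine Finset.sum_congr rfl fun i _ => ?_
    rw [linDeriv_congr (linDeriv_eventuallyEq hl), hlin, hlin]
    rfl
  rw [coe_casimir, hsum, ← map_sum, sum_rotGen_rotGen]
  simp [l, p]

end puncturedTest

end EvansLewis

/-! ### Assembly of the theorem -/

theorem theorem1p2 :
    -- all the norms in the statement are finite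
    (∀ f : EuclideanSpace ℝ (Fin 3) → ℂ, EvansLewis.IsPuncturedTestFunction f →
      MemLp (Laplacian.laplacian f) 2 volume ∧
      MemLp (EvansLewis.radialLaplacian f) 2 volume ∧
      MemLp (EvansLewis.sphericalLaplacian f) 2 volume) ∧
    -- the improved inequality
    (∀ f : EuclideanSpace ℝ (Fin 3) → ℂ, EvansLewis.IsPuncturedTestFunction f →
      EvansLewis.l2Norm (Laplacian.laplacian f) ^ 2 ≥
        EvansLewis.l2Norm (EvansLewis.radialLaplacian f) ^ 2 +
          (1 / 4 : ℝ) * EvansLewis.l2Norm (EvansLewis.sphericalLaplacian f) ^ 2) ∧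
    -- the improvement over `‖Δ f‖² ≥ ‖Δᵣ f‖²` is strict
    (∃ f : EuclideanSpace ℝ (Fin 3) → ℂ, EvansLewis.IsPuncturedTestFunction f ∧
      EvansLewis.l2Norm (EvansLewis.radialLaplacian f) ^ 2 +
          (1 / 4 : ℝ) * EvansLewis.l2Norm (EvansLewis.sphericalLaplacian f) ^ 2 >
        EvansLewis.l2Norm (EvansLewis.radialLaplacian f) ^ 2) ∧
    -- the weighted inequalities
    (∀ k₁ k₂ : ℝ, k₁ ∈ Set.Icc (0 : ℝ) 1 → k₂ ∈ Set.Icc (0 : ℝ) (25 / 64) →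
      9 * k₁ + 64 * k₂ ≤ 25 →
      ∀ f : EuclideanSpace ℝ (Fin 3) → ℂ, EvansLewis.IsPuncturedTestFunction f →
        EvansLewis.l2Norm (Laplacian.laplacian f) ^ 2 ≥
          k₁ * EvansLewis.l2Norm (EvansLewis.radialLaplacian f) ^ 2 +
            k₂ * EvansLewis.l2Norm (EvansLewis.sphericalLaplacian f) ^ 2) := by
  open EvansLewis EvansLewis.puncturedTest in
  have hΔ : ∀ f (hf : IsPuncturedTestFunction f),
      l2Norm (Laplacian.laplacian f) ^ 2
        = weightedInner (euler ⟨f, hf⟩ + casimir ⟨f, hf⟩) (euler ⟨f, hf⟩ + casimir ⟨f, hf⟩) :=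
    fun f hf => l2Norm_sq_of_eq_off_zero _ fun _ hx => laplacian_eq ⟨f, hf⟩ hx
  open EvansLewis EvansLewis.puncturedTest in
  have hr : ∀ f (hf : IsPuncturedTestFunction f),
      l2Norm (radialLaplacian f) ^ 2 = weightedInner (euler ⟨f, hf⟩) (euler ⟨f, hf⟩) :=
    fun f hf => l2Norm_sq_of_eq_off_zero _ fun _ hx => radialLaplacian_eq ⟨f, hf⟩ hx
  open EvansLewis EvansLewis.puncturedTest in
  have hs : ∀ f (hf : IsPuncturedTestFunction f),
      l2Norm (sphericalLaplacian f) ^ 2 = weightedInner (casimir ⟨f, hf⟩) (casimir ⟨f, hf⟩) :=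
    fun f hf => l2Norm_sq_of_eq_off_zero _ fun _ hx => sphericalLaplacian_eq ⟨f, hf⟩ hx
  open EvansLewis EvansLewis.puncturedTest in
  refine ⟨fun f hf => ⟨memLp_of_eq_off_zero _ fun _ hx => laplacian_eq ⟨f, hf⟩ hx,
    memLp_of_eq_off_zero _ fun _ hx => radialLaplacian_eq ⟨f, hf⟩ hx,
    memLp_of_eq_off_zero _ fun _ hx => sphericalLaplacian_eq ⟨f, hf⟩ hx⟩,
    fun f hf => ?_, ?_, fun k₁ k₂ hk₁ hk₂ hk f hf => ?_⟩
  · rw [hΔ f hf, hr f hf, hs f hf]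
    exact EvansLewis.puncturedTest.weightedInner_laplacian_ge _
  · obtain ⟨f, p, hp, hfp⟩ := EvansLewis.puncturedTest.exists_casimir_ne_zero
    refine ⟨f.1, f.2, ?_⟩
    rw [hs f.1 f.2]
    linarith [EvansLewis.puncturedTest.weightedInner_self_pos hp hfp]
  · rw [hΔ f hf, hr f hf, hs f hf]
    -- The bounds with (k₁, k₂) = (1, 1/4) and (0, 25/64) are combined with weights k₁ and 1 − k₁;
    -- the spherical coefficient becomes (25 − 9k₁)/64, which dominates k₂.
    have h1 := mul_le_mul_of_nonneg_left
      (EvansLewis.puncturedTest.weightedInner_laplacian_ge ⟨f, hf⟩) hk₁.1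
    have h2 := mul_le_mul_of_nonneg_left
      (EvansLewis.puncturedTest.weightedInner_laplacian_ge_casimir ⟨f, hf⟩) (sub_nonneg.2 hk₁.2)
    have h3 := mul_le_mul_of_nonneg_right (show k₂ ≤ (25 - 9 * k₁) / 64 by linarith)
      (EvansLewis.puncturedTest.weightedInner_self_nonneg
        (EvansLewis.puncturedTest.casimir ⟨f, hf⟩))
    linarith
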